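/- Let $\mathcal M=(S,A,P,s_0,AP,L)$ be a Markov decision process (MDP) with finite sets $S$ of states, $A$ of actions and $AP$ of atomic propositions, transition function $P:S\times A\times S\to[0,1]$, initial state $s_0$, labelling $L:S\to 2^{AP}$, and sets $A(s)\subseteq A$ of available actions, where $\sum_{q}P(s,a,q)=1$ for all $a\in A(s)$. A policy is a sequence $\pi=\mu_0\mu_1\cdots$ of functions $\mu_t:S\times A\to[0,1]$ with $\sum_{a\in A(s)}\mu_t(s,a)=1$ for every $s$; it is stationary if $\mu_t$ does not depend on $t$. $\Pi(\mathcal M)$ denotes the set of policies, and $\Gamma^\pi_{\mathcal M}$ the distribution of the infinite state paths $s_0s_1s_2\cdots$ under $\pi$, that is, from $s$ at time $t$ the path moves to $q$ with probability $\sum_{a\in A(s)}P(s,a,q)\mu_t(s,a)$. The expected state-action residence time is $$x^\pi_{s,a}=\sum_{t=0}^\infty \Pr{}^{\pi}(s_t=s\mid s_0)\,\mu_t(s,a)\in[0,\infty].$$ Let $\varphi^{\mathcal S}$ and $\varphi^{\mathcal A}$ (the supervisor's and the agent's specification) be co-safe linear temporal logic formulae over $AP$ (every word that satisfies the formula has a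 finite good prefix), represented by deterministic finite automata $\mathcal D_{\mathcal S}$ and $\mathcal D_{\mathcal A}$ over $2^{AP}$: an infinite word satisfies the formula if and only if the automaton is in an accepting state after reading some non-empty finite prefix of it. Let $\mathcal D$, with transition function $\delta$ and initial state $q_0$, be the product automaton of $\mathcal D_{\mathcal S}$ and $\mathcal D_{\mathcal A}$, and $\mathcal M_p$ the product MDP of $\mathcal M$ and $\mathcal D$: its states are the pairs $(s,q)$, the actions available at $(s,q)$ are those in $A(s)$, the transition probability from $(s,q)$ to $(s',q')$ under $a$ is $P(s,a,s')$ if $q'=\delta(q,L(s'))$ and $0$ otherwise, and the initial state is $s_{0_p}=(s_0,\delta(q_0,L(s_0)))$. Let $C_{\mathcal A}$ be the set of states of $\mathcal M_p$ whose $\mathcal D_{\mathcal A}$-component is accepting. Every policy on $\mathcal M$ induces one on $\mathcal M_p$ that ignores the automaton component. Let $\nu^{\mathcal A}\in[0,1]$, and let $\sigma$ be a stationary policy on $\mathcal M_p$ (the reference policy). Let $C_{cl}$ be the set of the states of $\mathcal M_p$ that belong to a closed communicating class of the Markov chain induced by $\sigma$ on $\mathcal M_p$. Then the following hold. 1. If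 the optimal value of $$\inf_{\pi\in\Pi(\mathcal M_p)} KL\bigl(\Gamma^{\pi}_{\mathcal M_p}\,\|\,\Gamma^{\sigma}_{\mathcal M_p}\bigr)\quad\text{subject to}\quad \Pr{}^{\pi}_{\mathcal M_p}(s_{0_p}\models\lozenge C_{\mathcal A})\ge\nu^{\mathcal A}$$ is finite and $\pi^{\mathcal A}\in\Pi(\mathcal M_p)$ is an optimal policy, then $x^{\pi^{\mathcal A}}_{s,a}<\infty$ for all states $s\notin C_{cl}$ of $\mathcal M_p$ and all actions $a$ available at $s$. 2. If $\pi^{\mathcal S}\in\Pi(\mathcal M)$ induces $\sigma$ on $\mathcal M_p$, the optimal value of $$\inf_{\pi\in\Pi(\mathcal M)} KL\bigl(\Gamma^{\pi}_{\mathcal M}\,\|\,\Gamma^{\pi^{\mathcal S}}_{\mathcal M}\bigr)\quad\text{subject to}\quad \Pr{}^{\pi}_{\mathcal M}(s_0\models\varphi^{\mathcal A})\ge\nu^{\mathcal A}$$ is finite and $\pi^{\mathcal A}\in\Pi(\mathcal M)$ is an optimal policy, then the policy that $\pi^{\mathcal A}$ induces on $\mathcal M_p$ has finite expected state-action residence time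 $x_{s,a}$ for all states $s\notin C_{cl}$ of $\mathcal M_p$ and all actions $a$ available at $s$. Here $KL$ is the Kullback--Leibler divergence with values in $[0,\infty]$, and the infimum over the empty set is $\infty$. -/

import Mathlib

open MeasureTheory ProbabilityTheory InformationTheory
open scoped ENNReal NNReal BigOperators

namespace Deceptive

/-- Linear temporal logic formulae over a set `AP` of atomic propositions. -/
inductive LTL (AP : Type*) where
  | tt : LTL AP
  | atom : AP → LTL AP
  | neg : LTL AP → LTL AP
  | and : LTL AP → LTL AP → LTL AP
  | or : LTL AP → LTL AP → LTL AP
  | imp : LTL AP → LTL AP → LTL AP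
  | next : LTL AP → LTL AP
  | eventually : LTL AP → LTL AP
  | always : LTL AP → LTL AP
  | untl : LTL AP → LTL AP → LTL AP

/-- Satisfaction of an LTL formula by an infinite word over the alphabet `2^AP`. -/
def LTL.Sat {AP : Type*} : LTL AP → (ℕ → Set AP) → Prop
  | .tt, _ => True
  | .atom p, w => p ∈ w 0
  | .neg φ, w => ¬ φ.Sat w
  | .and φ ψ, w => φ.Sat w ∧ ψ.Sat w
  | .or φ ψ, w => φ.Sat w ∨ ψ.Sat w
  | .imp φ ψ, w => φ.Sat w → ψ.Sat w
  | .next φ, w => φ.Sat (fun i => w (i + 1))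
  | .eventually φ, w => ∃ k, φ.Sat (fun i => w (k + i))
  | .always φ, w => ∀ k, φ.Sat (fun i => w (k + i))
  | .untl φ ψ, w =>
      ∃ k, ψ.Sat (fun i => w (k + i)) ∧ ∀ j < k, φ.Sat (fun i => w (j + i))

/-- A formula is co-safe if every word that satisfies it has a finite good prefix. -/
def LTL.IsCoSafe {AP : Type*} (φ : LTL AP) : Prop :=
  ∀ w, φ.Sat w → ∃ n, ∀ w' : ℕ → Set AP, (∀ i < n, w' i = w i) → φ.Sat w'

/-- The automaton `𝒜` represents `φ`: a word satisfies `φ` if and only if the run of `𝒜` on it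
visits an accepting state (the state `q_k` is the one reached after reading the letters
`w 0, …, w k`). -/
def Represents {AP Q : Type*} (𝒜 : DFA (Set AP) Q) (φ : LTL AP) : Prop :=
  ∀ w : ℕ → Set AP, φ.Sat w ↔ ∃ k : ℕ, 𝒜.eval ((List.range (k + 1)).map w) ∈ 𝒜.accept

/-- The product of two deterministic finite automata over the same alphabet. -/
def prodDFA {AP Q₁ Q₂ : Type*} (𝒜₁ : DFA (Set AP) Q₁) (𝒜₂ : DFA (Set AP) Q₂) :
    DFA (Set AP) (Q₁ × Q₂) where
  step q l := (𝒜₁.step q.1 l, 𝒜₂.step q.2 l)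
  start := (𝒜₁.start, 𝒜₂.start)
  accept := {q | q.1 ∈ 𝒜₁.accept ∧ q.2 ∈ 𝒜₂.accept}

/-- A Markov decision process with finite state space `S`, actions `A` and atomic propositions
`AP`; `avail s` is the set of actions available at `s`. -/
structure MDP (S A AP : Type*) [Fintype S] where
  avail : S → Finset A
  P : S → A → S → ℝ≥0
  P_le_one : ∀ s a q, P s a q ≤ 1
  P_sum : ∀ s, ∀ a ∈ avail s, ∑ q, P s a q = 1
  init : S
  label : S → Set AP

namespace MDP

variable {S A AP : Type*} [Fintype S]

/-- A policy `μ₀ μ₁ …`: at each time, a distribution over the available actions of each state. -/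
structure Policy (M : MDP S A AP) where
  prob : ℕ → S → A → ℝ≥0
  prob_le_one : ∀ t s a, prob t s a ≤ 1
  prob_sum : ∀ t s, ∑ a ∈ M.avail s, prob t s a = 1

/-- A stationary policy `μ μ …`. -/
structure StationaryPolicy (M : MDP S A AP) where
  prob : S → A → ℝ≥0
  prob_le_one : ∀ s a, prob s a ≤ 1
  prob_sum : ∀ s, ∑ a ∈ M.avail s, prob s a = 1

/-- A stationary policy, seen as a policy. -/
def StationaryPolicy.toPolicy {M : MDP S A AP} (σ : M.StationaryPolicy) : M.Policy where
  prob _ := σ.prob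
  prob_le_one _ := σ.prob_le_one
  prob_sum _ := σ.prob_sum

/-- The probability of moving from `s` to `q` when the action at `s` has distribution `d`. -/
def transProb (M : MDP S A AP) (d : A → ℝ≥0) (s q : S) : ℝ≥0 :=
  ∑ a ∈ M.avail s, M.P s a q * d a

theorem sum_transProb (M : MDP S A AP) (d : A → ℝ≥0) (s : S)
    (hd : ∑ a ∈ M.avail s, d a = 1) : ∑ q, (M.transProb d s q : ℝ≥0∞) = 1 := by
  have h : ∑ q, M.transProb d s q = 1 := by
    unfold transProb
    rw [Finset.sum_comm]
    calc ∑ a ∈ M.avail s, ∑ q, M.P s a q * d a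
        = ∑ a ∈ M.avail s, d a :=
          Finset.sum_congr rfl fun a ha => by rw [← Finset.sum_mul, M.P_sum s a ha, one_mul]
      _ = 1 := hd
  exact_mod_cast h

/-- The distribution of the successor of `s` at time `t` under the policy `π`. -/
noncomputable def Policy.step {M : MDP S A AP} (π : M.Policy) (t : ℕ) (s : S) : PMF S :=
  PMF.ofFintype (fun q => (M.transProb (π.prob t s) s q : ℝ≥0∞))
    (M.sum_transProb _ s (π.prob_sum t s))

variable [MeasurableSpace S] [MeasurableSingletonClass S]

/-- The transition kernel at time `t`, as a kernel from histories `s₀ … s_t` to states. -/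
noncomputable def Policy.kernel {M : MDP S A AP} (π : M.Policy) (t : ℕ) :
    Kernel ((_ : Finset.Iic t) → S) S :=
  Kernel.ofFunOfCountable fun h => (π.step t (h ⟨t, Finset.mem_Iic.2 le_rfl⟩)).toMeasure

instance Policy.isMarkovKernel_kernel {M : MDP S A AP} (π : M.Policy) (t : ℕ) :
    IsMarkovKernel (π.kernel t) :=
  ⟨fun h => PMF.toMeasure.isProbabilityMeasure (π.step t (h ⟨t, Finset.mem_Iic.2 le_rfl⟩))⟩

/-- The distribution of the infinite paths `s₀ s₁ s₂ …` under the policy `π`. -/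
noncomputable def Policy.pathMeasure {M : MDP S A AP} (π : M.Policy) : Measure (ℕ → S) :=
  Kernel.trajMeasure (X := fun _ => S) (Measure.dirac M.init) π.kernel

/-- The expected state-action residence time `∑ₜ Pr(sₜ = s | s₀) μₜ(s, a)`, in `[0, ∞]`. -/
noncomputable def Policy.residenceTime {M : MDP S A AP} (π : M.Policy) (s : S) (a : A) : ℝ≥0∞ :=
  ∑' t : ℕ, π.pathMeasure {ω | ω t = s} * (π.prob t s a : ℝ≥0∞)

/-- `π` satisfies the task given by the set of paths `E` with probability at least `ν`. -/
def Policy.Feasible {M : MDP S A AP} (π : M.Policy) (E : Set (ℕ → S)) (ν : ℝ) : Prop :=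
  ν ≤ (π.pathMeasure E).toReal

/-- The optimal value of the deceptive problem: the infimum of the Kullback--Leibler divergence
from the path distribution of the reference policy, over the policies that satisfy the task `E`
with probability at least `ν` (it is `∞` if there are none). -/
noncomputable def deceptiveValue {M : MDP S A AP} (πref : M.Policy) (E : Set (ℕ → S)) (ν : ℝ) :
    ℝ≥0∞ :=
  ⨅ (π : M.Policy) (_ : π.Feasible E ν), klDiv π.pathMeasure πref.pathMeasure

/-- `π` is an optimal policy of the deceptive problem. -/
def IsOptimalDeceptive {M : MDP S A AP} (πref : M.Policy) (E : Set (ℕ → S)) (ν : ℝ)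
    (π : M.Policy) : Prop :=
  π.Feasible E ν ∧ klDiv π.pathMeasure πref.pathMeasure = deceptiveValue πref E ν

end MDP

/-- The paths that reach the set of states `C`. -/
def reachPaths {S : Type*} (C : Set S) : Set (ℕ → S) :=
  {ω | ∃ k, ω k ∈ C}

namespace MDP

variable {S A AP : Type*} [Fintype S]

/-- The paths of `M` whose label sequence satisfies `φ`. -/
def satPaths (M : MDP S A AP) (φ : LTL AP) : Set (ℕ → S) :=
  {ω | φ.Sat fun t => M.label (ω t)}

/-- The transition probabilities of the Markov chain induced by a stationary policy. -/
def StationaryPolicy.chain {M : MDP S A AP} (σ : M.StationaryPolicy) (s q : S) : ℝ≥0 :=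
  M.transProb (σ.prob s) s q

/-- `q` is accessible from `s` in the chain induced by `σ`. -/
def StationaryPolicy.Accessible {M : MDP S A AP} (σ : M.StationaryPolicy) (s q : S) : Prop :=
  Relation.ReflTransGen (fun u v => 0 < σ.chain u v) s q

def StationaryPolicy.IsCommunicating {M : MDP S A AP} (σ : M.StationaryPolicy) (C : Set S) :
    Prop :=
  ∀ s ∈ C, ∀ q ∈ C, σ.Accessible s q ∧ σ.Accessible q s

def StationaryPolicy.IsClosedClass {M : MDP S A AP} (σ : M.StationaryPolicy) (C : Set S) :
    Prop :=
  σ.IsCommunicating C ∧ ∀ s ∈ C, ∀ q ∉ C, ¬ σ.Accessible s q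

/-- The states that belong to a closed communicating class of the chain induced by `σ`. -/
def StationaryPolicy.closedStates {M : MDP S A AP} (σ : M.StationaryPolicy) : Set S :=
  {s | ∃ C : Set S, σ.IsClosedClass C ∧ s ∈ C}

open Classical in
/-- The product of an MDP with a deterministic finite automaton over the alphabet `2^AP`. -/
noncomputable def prod {Q : Type*} [Fintype Q] (M : MDP S A AP) (𝒜 : DFA (Set AP) Q) :
    MDP (S × Q) A Q where
  avail s := M.avail s.1
  P s a s' := if s'.2 = 𝒜.step s.2 (M.label s'.1) then M.P s.1 a s'.1 else 0
  P_le_one s a s' := by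
    split_ifs
    · exact M.P_le_one _ _ _
    · exact zero_le_one
  P_sum s a ha := by
    rw [Fintype.sum_prod_type]
    simpa using M.P_sum s.1 a ha
  init := (M.init, 𝒜.step 𝒜.start (M.label M.init))
  label s := {s.2}

/-- The policy on the product MDP that is induced by a policy on the MDP. -/
def Policy.induced {Q : Type*} [Fintype Q] {M : MDP S A AP} (π : M.Policy)
    (𝒜 : DFA (Set AP) Q) : (M.prod 𝒜).Policy where
  prob t s a := π.prob t s.1 a
  prob_le_one t s a := π.prob_le_one t s.1 a
  prob_sum t s := π.prob_sum t s.1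

end MDP

/-- The accepting states, for the agent's specification, of the product of an MDP with the product
of the supervisor's automaton and the agent's automaton `𝒜A`. -/
def agentAccepting (S : Type*) {AP QS QA : Type*} (𝒜A : DFA (Set AP) QA) :
    Set (S × (QS × QA)) :=
  {s | s.2.2 ∈ 𝒜A.accept}

end Deceptive

/-! Under `σ`, the time `T` spent outside the closed classes has an exponential moment: `ρ ^ T` has
expectation at most `2` for some `ρ > 1`. The Donsker–Varadhan inequality turns this into a bound on
the expectation of `T` under any path measure at finite divergence `KL` from that of `σ`: it is at
most `(KL + log 2) / log ρ`. This dominates every residence time outside `closedStates`, and an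
optimal policy with finite value has finite divergence.

The moment comes from a Lyapunov function (`exists_lyapunov`), which exists because the closed
classes of a finite chain are absorbing and accessible from everywhere. For policies on the original
MDP, `pathMeasure_induced` shows that path measures on the product are images under one map,
`liftPath`, and the divergence does not grow under a map. -/

namespace Deceptive

/-! ### Change of measure, and Lyapunov functions of finite chains -/

/-- The Donsker--Varadhan inequality. -/
theorem integral_le_klDiv_add_log {Ω : Type*} [MeasurableSpace Ω] {μ ν : Measure Ω}
    [IsProbabilityMeasure μ] [IsProbabilityMeasure ν] (h : klDiv μ ν ≠ ∞) {f : Ω → ℝ}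
    (hfμ : Integrable f μ) (hfν : Integrable (fun x => Real.exp (f x)) ν) :
    ∫ x, f x ∂μ ≤ (klDiv μ ν).toReal + Real.log (∫ x, Real.exp (f x) ∂ν) := by
  obtain ⟨hac, hint⟩ := klDiv_ne_top_iff.1 h
  -- The inequality is the nonnegativity of the divergence from `μ` to the tilted measure.
  have : IsProbabilityMeasure (ν.tilted f) := isProbabilityMeasure_tilted hfν
  have hac' : μ ≪ ν.tilted f := hac.trans (absolutelyContinuous_tilted hfν)
  have h1 := integral_llr_tilted_right hac hfμ hfν hint
  have h2 := toReal_klDiv_of_measure_eq hac (by simp)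
  have h3 := toReal_klDiv_of_measure_eq hac' (by simp)
  have h4 : 0 ≤ (klDiv μ (ν.tilted f)).toReal := ENNReal.toReal_nonneg
  linarith

/-- If every point is related to the set `K` by a finite chain, then the distance to `K` decreases
along some step from every point outside `K`. -/
theorem exists_dist_of_reflTransGen {S : Type*} (r : S → S → Prop) (K : Set S)
    (h : ∀ s, ∃ q ∈ K, Relation.ReflTransGen r s q) :
    ∃ d : S → ℕ, (∀ s ∈ K, d s = 0) ∧ ∀ s ∉ K, ∃ q, r s q ∧ d q < d s := by
  classical
  -- `R n s` says that some chain of exactly `n` steps leads from `s` into `K`; `d` is the least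
  -- such `n`.
  let R : ℕ → S → Prop := fun n =>
    Nat.rec (motive := fun _ => S → Prop) (fun s => s ∈ K) (fun _ R s => ∃ q, r s q ∧ R q) n
  have hR : ∀ s, ∃ n, R n s := by
    intro s
    obtain ⟨q, hq, hs⟩ := h s
    induction hs using Relation.ReflTransGen.head_induction_on with
    | refl => exact ⟨0, hq⟩
    | head hab _ ih =>
      obtain ⟨n, hn⟩ := ih
      exact ⟨n + 1, _, hab, hn⟩
  let d : S → ℕ := fun s => Nat.find (hR s)
  refine ⟨d, fun s hs => (Nat.find_eq_zero (hR s)).2 hs, fun s hs => ?_⟩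
  have hf : R (d s) s := Nat.find_spec (hR s)
  rcases hn : d s with _ | n
  · rw [hn] at hf
    exact absurd hf hs
  · rw [hn] at hf
    obtain ⟨q, hsq, hq⟩ := hf
    exact ⟨q, hsq, Nat.lt_succ_of_le (Nat.find_min' (hR q) hq)⟩

theorem exists_pos_le_of_finite {ι : Type*} [Finite ι] (f : ι → ℝ) :
    ∃ ε : ℝ, 0 < ε ∧ ε ≤ 1 ∧ ∀ i, 0 < f i → ε ≤ f i := by
  have h : ∀ᶠ ε : ℝ in nhdsWithin 0 (Set.Ioi 0), 0 < ε ∧ ε ≤ 1 ∧ ∀ i, 0 < f i → ε ≤ f i := by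
    refine Filter.Eventually.and self_mem_nhdsWithin (Filter.Eventually.and ?_ ?_)
    · exact nhdsWithin_le_nhds (Iic_mem_nhds one_pos)
    · refine Filter.eventually_all.2 fun i => ?_
      by_cases hi : 0 < f i
      · filter_upwards [nhdsWithin_le_nhds (Iic_mem_nhds hi)] with ε hε _ using hε
      · exact Filter.Eventually.of_forall fun ε h => absurd h hi
  exact h.exists

/-- A Lyapunov function for a finite stochastic matrix `c` and a set `K` that is closed under the
steps of positive probability and can be reached from everywhere. -/
theorem exists_lyapunov {S : Type*} [Fintype S] (c : S → S → ℝ) (hc0 : ∀ s q, 0 ≤ c s q)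
    (hc1 : ∀ s, ∑ q, c s q = 1) (K : Set S) (hK : ∀ s ∈ K, ∀ q, 0 < c s q → q ∈ K)
    (hreach : ∀ s, ∃ q ∈ K, Relation.ReflTransGen (fun u v => 0 < c u v) s q) :
    ∃ ρ : ℝ, 1 < ρ ∧ ∃ V : S → ℝ, (∀ s, 1 ≤ V s) ∧ (∀ s, V s ≤ 2) ∧
      (∀ s ∈ K, ∑ q, c s q * V q ≤ V s) ∧ ∀ s ∉ K, ρ * ∑ q, c s q * V q ≤ V s := by
  obtain ⟨d, hd0, hd⟩ := exists_dist_of_reflTransGen _ K hreach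
  obtain ⟨ε, hε, hε1, hεc⟩ := exists_pos_le_of_finite fun p : S × S => c p.1 p.2
  have hη : 0 < ε / 2 := by linarith
  have hη1 : ε / 2 ≤ 1 := by linarith
  -- From a state outside `K`, a step that lowers `d` has probability at least `ε` and multiplies
  -- `g` by at least `2 / ε`, so the mean of `g` at least doubles. Hence the mean of `V = 2 - g`
  -- drops by at least `g ≥ δ`, which pays for the factor `ρ = (1 - δ / 2)⁻¹`.
  set g : S → ℝ := fun s => (ε / 2) ^ d s with hg
  have hg0 : ∀ s, 0 < g s := fun s => pow_pos hη _
  have hg1 : ∀ s, g s ≤ 1 := fun s => pow_le_one₀ hη.le hη1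
  obtain ⟨δ, hδ, hδ1, hδg⟩ := exists_pos_le_of_finite g
  have hsum : ∀ s, ∑ q, c s q * (2 - g q) = 2 - ∑ q, c s q * g q := by
    intro s
    simp only [mul_sub, Finset.sum_sub_distrib, ← Finset.sum_mul, hc1, one_mul]
  have hρ : 0 < 1 - δ / 2 := by linarith
  refine ⟨(1 - δ / 2)⁻¹, one_lt_inv_iff₀.2 ⟨hρ, by linarith⟩, fun s => 2 - g s,
    fun s => by linarith [hg1 s], fun s => by linarith [hg0 s], fun s hs => ?_, fun s hs => ?_⟩
  · rw [hsum]
    have : ∑ q, c s q * g q = 1 := by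
      rw [← hc1 s]
      refine Finset.sum_congr rfl fun q _ => ?_
      rcases (hc0 s q).eq_or_lt with h | h
      · rw [← h, zero_mul]
      · simp [hg, hd0 q (hK s hs q h)]
    linarith [hg1 s]
  · rw [hsum, inv_mul_le_iff₀ hρ]
    obtain ⟨q, hsq, hq⟩ := hd s hs
    have h1 : c s q * g q ≤ ∑ q, c s q * g q :=
      Finset.single_le_sum (f := fun q => c s q * g q)
        (fun q _ => mul_nonneg (hc0 s q) (hg0 q).le) (Finset.mem_univ q)
    have h2 : 2 * g s ≤ c s q * g q := by
      have h3 : g s ≤ (ε / 2) ^ (d q + 1) := pow_le_pow_of_le_one hη.le hη1 hq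
      rw [pow_succ] at h3
      have h4 := mul_le_mul_of_nonneg_right (hεc (s, q) hsq) (hg0 q).le
      simp only [hg] at h3 h4 ⊢
      linarith
    have h5 := hδg s (hg0 s)
    nlinarith [hg0 s]

namespace MDP

variable {S A AP : Type*} [Fintype S] {M : MDP S A AP}

namespace StationaryPolicy

theorem mem_closedStates_of_chain_pos (σ : M.StationaryPolicy) {s q : S}
    (hs : s ∈ σ.closedStates) (h : 0 < σ.chain s q) : q ∈ σ.closedStates := by
  obtain ⟨C, hC, hsC⟩ := hs
  refine ⟨C, hC, ?_⟩
  by_contra hq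
  exact hC.2 s hsC q hq (Relation.ReflTransGen.single h)

/-- Among the states accessible from `s`, take `q` whose own accessible set is smallest. Any `r`
accessible from `q` has the same accessible set by minimality, so it leads back to `q`, and this set
is a closed class. -/
theorem exists_accessible_closedStates (σ : M.StationaryPolicy) (s : S) :
    ∃ q ∈ σ.closedStates, σ.Accessible s q := by
  obtain ⟨q, hq, hmin⟩ := Set.exists_min_image {q | σ.Accessible s q}
    (fun q => {r | σ.Accessible q r}.ncard) (Set.toFinite _) ⟨s, Relation.ReflTransGen.refl⟩
  have hback : ∀ r, σ.Accessible q r → σ.Accessible r q := by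
    intro r hr
    have hsub : {t | σ.Accessible r t} ⊆ {t | σ.Accessible q t} := fun t ht => hr.trans ht
    have heq := Set.eq_of_subset_of_ncard_le hsub (hmin r (hq.trans hr)) (Set.toFinite _)
    have : q ∈ {t | σ.Accessible r t} := heq ▸ Relation.ReflTransGen.refl
    exact this
  exact ⟨q, ⟨{r | σ.Accessible q r},
    ⟨fun u hu v hv => ⟨(hback u hu).trans hv, (hback v hv).trans hu⟩,
      fun u hu v hv huv => hv (hu.trans huv)⟩, Relation.ReflTransGen.refl⟩, hq⟩

open Classical in
theorem exists_lyapunov (σ : M.StationaryPolicy) :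
    ∃ ρ : ℝ≥0, 1 < ρ ∧ ∃ V : S → ℝ≥0, (∀ s, 1 ≤ V s) ∧ (∀ s, V s ≤ 2) ∧
      ∀ s, (if s ∈ σ.closedStates then 1 else ρ) * ∑ q, σ.chain s q * V q ≤ V s := by
  obtain ⟨ρ, hρ, V, hV1, hV2, hK, hN⟩ := Deceptive.exists_lyapunov
    (fun s q => (σ.chain s q : ℝ)) (fun _ _ => NNReal.coe_nonneg _)
    (fun s => by
      have := M.sum_transProb (σ.prob s) s (σ.prob_sum s)
      exact_mod_cast this) σ.closedStates
    (fun s hs q h => σ.mem_closedStates_of_chain_pos hs (by exact_mod_cast h))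
    (fun s => by
      obtain ⟨q, hq, h⟩ := σ.exists_accessible_closedStates s
      exact ⟨q, hq, by simpa [Accessible] using h⟩)
  lift ρ to ℝ≥0 using by linarith
  lift V to S → ℝ≥0 using fun s => by linarith [hV1 s]
  refine ⟨ρ, by exact_mod_cast hρ, V, fun s => by exact_mod_cast hV1 s,
    fun s => by exact_mod_cast hV2 s, fun s => ?_⟩
  split_ifs with hs
  · rw [one_mul]
    have := hK s hs
    dsimp only at this
    exact_mod_cast this
  · have := hN s hs
    dsimp only at this
    exact_mod_cast this

end StationaryPolicy

end MDP
end Deceptive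

/-! ### Path measures: Markov property, uniqueness, exponential moment -/

namespace Deceptive
namespace MDP

open Preorder (frestrictLe)

variable {S A AP : Type*} [Fintype S] [MeasurableSpace S] [MeasurableSingletonClass S]
  {M : MDP S A AP}

instance Policy.isProbabilityMeasure_pathMeasure (π : M.Policy) :
    IsProbabilityMeasure π.pathMeasure := by
  unfold Policy.pathMeasure
  infer_instance

theorem Policy.ae_pathMeasure_zero (π : M.Policy) : ∀ᵐ ω ∂π.pathMeasure, ω 0 = M.init := by
  have h : π.pathMeasure.map (frestrictLe 0) =
      (Measure.dirac M.init).map (MeasurableEquiv.piUnique (fun _ : Finset.Iic 0 => S)).symm := by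
    unfold Policy.pathMeasure Kernel.trajMeasure
    rw [Measure.map_comp _ _ (by fun_prop), Kernel.traj_map_frestrictLe, Kernel.partialTraj_self,
      Measure.id_comp]
  have h' : ∀ᵐ x ∂π.pathMeasure.map (frestrictLe (π := fun _ => S) 0),
      x ⟨0, by simp⟩ = M.init := by
    rw [h]
    refine (ae_map_iff (MeasurableEquiv.measurable _).aemeasurable
      (measurable_pi_apply _ (measurableSet_singleton _))).2 ?_
    rw [ae_dirac_eq]
    rfl
  exact ae_of_ae_map (by fun_prop) h'

/-- The Markov property of the path distribution. -/
theorem Policy.lintegral_pathMeasure_succ (π : M.Policy) (n : ℕ)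
    (G : ((_ : Finset.Iic n) → S) → S → ℝ≥0∞) :
    ∫⁻ ω, G (frestrictLe n ω) (ω (n + 1)) ∂π.pathMeasure =
      ∫⁻ ω, ∑ q, (M.transProb (π.prob n (ω n)) (ω n) q : ℝ≥0∞) * G (frestrictLe n ω) q
        ∂π.pathMeasure := by
  have hG : Measurable fun p : ((_ : Finset.Iic n) → S) × S => G p.1 p.2 :=
    measurable_of_countable _
  have h := Kernel.map_frestrictLe_trajMeasure_compProd_eq_map_trajMeasure (X := fun _ => S)
    (μ₀ := Measure.dirac M.init) (κ := π.kernel) (a := n)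
  calc ∫⁻ ω, G (frestrictLe n ω) (ω (n + 1)) ∂π.pathMeasure
      = ∫⁻ p, G p.1 p.2 ∂(π.pathMeasure.map fun x => (frestrictLe n x, x (n + 1))) := by
        rw [lintegral_map hG (by fun_prop)]
    _ = ∫⁻ h, ∫⁻ q, G h q ∂π.kernel n h ∂(π.pathMeasure.map (frestrictLe n)) := by
        unfold Policy.pathMeasure
        rw [← h, Measure.lintegral_compProd hG]
    _ = ∫⁻ ω, ∫⁻ q, G (frestrictLe n ω) q ∂π.kernel n (frestrictLe n ω) ∂π.pathMeasure := by
        rw [lintegral_map (measurable_of_countable _) (by fun_prop)]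
    _ = _ := by
        refine lintegral_congr fun ω => ?_
        rw [lintegral_fintype]
        refine Finset.sum_congr rfl fun q _ => ?_
        rw [mul_comm]
        congr 1
        exact PMF.toMeasure_apply_singleton _ q (measurableSet_singleton q)

/-- The path distribution is the only one with its initial state and the Markov property. -/
theorem Policy.eq_pathMeasure (π : M.Policy) (μ : Measure (ℕ → S)) [IsProbabilityMeasure μ]
    (h0 : ∀ᵐ ω ∂μ, ω 0 = M.init)
    (h : ∀ (n : ℕ) (G : ((_ : Finset.Iic n) → S) → S → ℝ≥0∞),
      ∫⁻ ω, G (frestrictLe n ω) (ω (n + 1)) ∂μ =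
        ∫⁻ ω, ∑ q, (M.transProb (π.prob n (ω n)) (ω n) q : ℝ≥0∞) * G (frestrictLe n ω) q ∂μ) :
    μ = π.pathMeasure := by
  have key : ∀ (n : ℕ) (H : ((_ : Finset.Iic n) → S) → ℝ≥0∞),
      ∫⁻ ω, H (frestrictLe n ω) ∂μ = ∫⁻ ω, H (frestrictLe n ω) ∂π.pathMeasure := by
    intro n
    induction n with
    | zero =>
      intro H
      have aux : ∀ ν : Measure (ℕ → S), IsProbabilityMeasure ν → (∀ᵐ ω ∂ν, ω 0 = M.init) →
          ∫⁻ ω, H (frestrictLe 0 ω) ∂ν = H fun _ => M.init := by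
        intro ν _ hν
        rw [lintegral_congr_ae (g := fun _ => H fun _ => M.init), lintegral_const, measure_univ,
          mul_one]
        filter_upwards [hν] with ω hω
        congr 1
        ext ⟨i, hi⟩
        obtain rfl : i = 0 := by simpa using hi
        exact hω
      rw [aux μ inferInstance h0, aux _ inferInstance π.ae_pathMeasure_zero]
    | succ n ih =>
      intro H
      -- Splitting off the last state puts `H` in the form required by the Markov property.
      let G : ((_ : Finset.Iic n) → S) → S → ℝ≥0∞ := fun x q =>
        H fun i => if hi : i.1 ≤ n then x ⟨i.1, Finset.mem_Iic.2 hi⟩ else q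
      have hG : ∀ ω : ℕ → S, H (frestrictLe (n + 1) ω) = G (frestrictLe n ω) (ω (n + 1)) := by
        intro ω
        simp only [G]
        congr 1
        ext ⟨i, hi⟩
        by_cases hin : i ≤ n
        · simp [hin]
        · obtain rfl : i = n + 1 := by
            have := Finset.mem_Iic.1 hi
            omega
          simp
      simp only [hG]
      rw [h, π.lintegral_pathMeasure_succ]
      exact ih fun x => ∑ q, (M.transProb (π.prob n (x ⟨n, Finset.mem_Iic.2 le_rfl⟩))
        (x ⟨n, Finset.mem_Iic.2 le_rfl⟩) q : ℝ≥0∞) * G x q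
  have hmap : ∀ n, μ.map (frestrictLe n) = π.pathMeasure.map (frestrictLe n) := by
    intro n
    refine Measure.ext fun s hs => ?_
    have := key n (s.indicator 1)
    rw [← lintegral_indicator_one hs, ← lintegral_indicator_one hs,
      lintegral_map (measurable_of_countable _) (by fun_prop),
      lintegral_map (measurable_of_countable _) (by fun_prop), this]
  refine IsProjectiveLimit.unique (P := fun I => μ.map I.restrict) (fun I => rfl) ?_
  intro I
  change π.pathMeasure.map I.restrict = μ.map I.restrict
  -- Every finite set of times lies in an initial segment, so the marginals in `hmap` determine all
  -- finite-dimensional ones.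
  have hI : I ⊆ Finset.Iic (I.sup id) := fun i hi => Finset.mem_Iic.2 (Finset.le_sup (f := id) hi)
  have hr : (I.restrict : (ℕ → S) → _) =
      Finset.restrict₂ (π := fun _ => S) hI ∘ frestrictLe (I.sup id) := rfl
  rw [hr, ← Measure.map_map (by fun_prop) (by fun_prop),
    ← Measure.map_map (by fun_prop) (by fun_prop), hmap]

open Classical in
/-- Under a stationary policy, the time spent outside the closed communicating classes has an
exponential moment. -/
theorem StationaryPolicy.exists_exp_moment (σ : M.StationaryPolicy) :
    ∃ ρ : ℝ≥0, 1 < ρ ∧ ∀ n : ℕ,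
      ∫⁻ ω, ∏ t ∈ Finset.range n, (if ω t ∈ σ.closedStates then 1 else (ρ : ℝ≥0∞)) ∂σ.toPolicy.pathMeasure ≤ 2 := by
  obtain ⟨ρ, hρ, V, hV1, hV2, hV⟩ := σ.exists_lyapunov
  refine ⟨ρ, hρ, fun n => ?_⟩
  set w : S → ℝ≥0∞ := fun s => if s ∈ σ.closedStates then 1 else (ρ : ℝ≥0∞) with hw
  have hwV : ∀ s, w s * ∑ q, (σ.chain s q : ℝ≥0∞) * V q ≤ V s := by
    intro s
    have h1 : w s = ((if s ∈ σ.closedStates then 1 else ρ : ℝ≥0) : ℝ≥0∞) := by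
      by_cases hs : s ∈ σ.closedStates <;> simp [hw, hs]
    rw [h1]
    exact_mod_cast hV s
  -- The weighted process is a supermartingale by `hwV`; it starts at `V ≤ 2`, and `V ≥ 1` allows
  -- the last factor to be dropped.
  have key : ∀ n, ∫⁻ ω, (∏ t ∈ Finset.range n, w (ω t)) * V (ω n) ∂σ.toPolicy.pathMeasure ≤ 2 := by
    intro n
    induction n with
    | zero =>
      calc _ ≤ ∫⁻ _, 2 ∂σ.toPolicy.pathMeasure := by
            refine lintegral_mono fun ω => ?_
            simpa using (by exact_mod_cast hV2 (ω 0) : (V (ω 0) : ℝ≥0∞) ≤ 2)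
        _ = 2 := by simp
    | succ n ih =>
      refine le_trans ?_ ih
      have h := σ.toPolicy.lintegral_pathMeasure_succ n fun x q =>
        (∏ t : Fin (n + 1), w (x ⟨t, Finset.mem_Iic.2 (Nat.lt_succ_iff.1 t.2)⟩)) * V q
      have hp : ∀ ω : ℕ → S, ∏ t ∈ Finset.range (n + 1), w (ω t) = ∏ t : Fin (n + 1), w (ω t) :=
        fun ω => Finset.prod_range fun t => w (ω t)
      simp only [frestrictLe, Finset.restrict, ← hp] at h
      rw [h]
      refine lintegral_mono fun ω => ?_
      calc _ = (∏ t ∈ Finset.range n, w (ω t)) *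
            (w (ω n) * ∑ q, (σ.chain (ω n) q : ℝ≥0∞) * V q) := by
            rw [Finset.mul_sum, Finset.mul_sum]
            refine Finset.sum_congr rfl fun q _ => ?_
            rw [Finset.prod_range_succ, StationaryPolicy.chain, StationaryPolicy.toPolicy]
            ring
        _ ≤ _ := by gcongr; exact hwV _
  refine le_trans (lintegral_mono fun ω => ?_) (key n)
  exact le_mul_of_one_le_right' (ENNReal.one_le_coe_iff.2 (hV1 (ω n)))

end MDP
end Deceptive

/-! ### Residence times, and the product with an automaton -/

namespace Deceptive
namespace MDP

open Preorder (frestrictLe)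

section Product

variable {S A AP Q : Type*} [Fintype S] {M : MDP S A AP}

/-- The path of the product MDP that corresponds to a path of the MDP. -/
def liftPath (M : MDP S A AP) (𝒜 : DFA (Set AP) Q) (ω : ℕ → S) : ℕ → S × Q
  | 0 => (ω 0, 𝒜.step 𝒜.start (M.label (ω 0)))
  | n + 1 => (ω (n + 1), 𝒜.step (liftPath M 𝒜 ω n).2 (M.label (ω (n + 1))))

theorem liftPath_fst (𝒜 : DFA (Set AP) Q) (ω : ℕ → S) (n : ℕ) : (M.liftPath 𝒜 ω n).1 = ω n := by
  cases n <;> rfl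

theorem liftPath_congr (𝒜 : DFA (Set AP) Q) {ω ω' : ℕ → S} {n : ℕ} (h : ∀ i ≤ n, ω i = ω' i) :
    M.liftPath 𝒜 ω n = M.liftPath 𝒜 ω' n := by
  induction n with
  | zero => simp [liftPath, h]
  | succ n ih => simp [liftPath, h, ih fun i hi => h i (hi.trans n.le_succ)]

theorem Policy.sum_transProb_induced (π : M.Policy) [Fintype Q] (𝒜 : DFA (Set AP) Q) (n : ℕ) (x : S × Q)
    (G : S × Q → ℝ≥0∞) :
    ∑ y, ((M.prod 𝒜).transProb ((π.induced 𝒜).prob n x) x y : ℝ≥0∞) * G y =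
      ∑ s, (M.transProb (π.prob n x.1) x.1 s : ℝ≥0∞) * G (s, 𝒜.step x.2 (M.label s)) := by
  rw [Fintype.sum_prod_type]
  refine Finset.sum_congr rfl fun s _ => ?_
  rw [Finset.sum_eq_single (𝒜.step x.2 (M.label s))]
  · simp [transProb, prod, Policy.induced]
  · intro q _ hq
    simp [transProb, prod, hq]
  · simp

end Product

variable {S A AP : Type*} [Fintype S] [MeasurableSpace S] [MeasurableSingletonClass S]
  {M : MDP S A AP}

/-- A policy at finite divergence from a stationary policy `σ` spends a finite expected time
outside the closed communicating classes of `σ`. -/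
theorem Policy.residenceTime_lt_top (π : M.Policy) (σ : M.StationaryPolicy)
    (h : klDiv π.pathMeasure σ.toPolicy.pathMeasure ≠ ∞) {s : S} (hs : s ∉ σ.closedStates)
    {a : A} : π.residenceTime s a < ∞ := by
  classical
  obtain ⟨ρ, hρ, hmom⟩ := σ.exists_exp_moment
  have hρ0 : (0 : ℝ) < ρ := by exact_mod_cast zero_lt_one.trans hρ
  have hlog : 0 < Real.log ρ := Real.log_pos (by exact_mod_cast hρ)
  set B : ℝ := ((klDiv π.pathMeasure σ.toPolicy.pathMeasure).toReal + Real.log 2) / Real.log ρ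
    with hB
  have hsum : ∀ n : ℕ, ∑ t ∈ Finset.range n, π.pathMeasure {ω | ω t = s} ≤ ENNReal.ofReal B := by
    intro n
    -- Truncation at time `n` keeps `f` bounded, hence integrable; the resulting bound `B` does not
    -- depend on `n`.
    let f : (ℕ → S) → ℝ := fun ω =>
      ∑ t ∈ Finset.range n, if ω t ∈ σ.closedStates then 0 else Real.log ρ
    have hterm : ∀ t, Measurable fun ω : ℕ → S =>
        if ω t ∈ σ.closedStates then 0 else Real.log ρ := fun t =>
      (measurable_of_countable fun s : S => if s ∈ σ.closedStates then 0 else Real.log ρ).comp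
        (measurable_pi_apply t)
    have hfm : Measurable f := Finset.measurable_sum _ fun t _ => hterm t
    have hexp : ∀ ω, Real.exp (f ω) =
        ((∏ t ∈ Finset.range n, if ω t ∈ σ.closedStates then 1 else (ρ : ℝ≥0∞)) : ℝ≥0∞).toReal := by
      intro ω
      simp only [f]
      rw [Real.exp_sum, ENNReal.toReal_prod]
      refine Finset.prod_congr rfl fun t _ => ?_
      split_ifs
      · simp
      · simp [Real.exp_log hρ0]
    have hf0 : ∀ ω, 0 ≤ f ω := fun ω => Finset.sum_nonneg fun t _ => by
      split_ifs
      exacts [le_rfl, hlog.le]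
    have hfn : ∀ ω, f ω ≤ n * Real.log ρ := fun ω => by
      refine (Finset.sum_le_card_nsmul _ _ (Real.log ρ) fun t _ => ?_).trans (by simp)
      split_ifs
      exacts [hlog.le, le_rfl]
    have hfπ : Integrable f π.pathMeasure :=
      Integrable.of_bound hfm.aestronglyMeasurable (n * Real.log ρ)
        (Filter.Eventually.of_forall fun ω => by
          rw [Real.norm_eq_abs, abs_of_nonneg (hf0 ω)]
          exact hfn ω)
    have hfσ : Integrable (fun ω => Real.exp (f ω)) σ.toPolicy.pathMeasure :=
      Integrable.of_bound hfm.exp.aestronglyMeasurable (Real.exp (n * Real.log ρ))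
        (Filter.Eventually.of_forall fun ω => by
          rw [Real.norm_eq_abs, abs_of_pos (Real.exp_pos _)]
          exact Real.exp_le_exp.2 (hfn ω))
    have hdv := integral_le_klDiv_add_log h hfπ hfσ
    have hmoment : ∫ ω, Real.exp (f ω) ∂σ.toPolicy.pathMeasure ≤ 2 := by
      rw [integral_eq_lintegral_of_nonneg_ae
        (Filter.Eventually.of_forall fun ω => (Real.exp_pos _).le) hfσ.aestronglyMeasurable]
      refine ENNReal.toReal_le_of_le_ofReal two_pos.le ?_
      refine le_trans (le_of_eq (lintegral_congr fun ω => ?_)) ((hmom n).trans (by simp))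
      rw [hexp, ENNReal.ofReal_toReal]
      refine ENNReal.prod_ne_top fun t _ => ?_
      split_ifs <;> simp
    have hpos : 0 < ∫ ω, Real.exp (f ω) ∂σ.toPolicy.pathMeasure := integral_exp_pos hfσ
    have hle : ∫ ω, f ω ∂π.pathMeasure ≤ B * Real.log ρ := by
      rw [hB, div_mul_cancel₀ _ hlog.ne']
      linarith [Real.log_le_log hpos hmoment]
    have hmeas : ∀ t, MeasurableSet {ω : ℕ → S | ω t = s} := fun t =>
      (measurable_pi_apply (X := fun _ => S) t) (measurableSet_singleton s)
    have hreal : (∑ t ∈ Finset.range n, π.pathMeasure.real {ω | ω t = s}) * Real.log ρ ≤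
        ∫ ω, f ω ∂π.pathMeasure := by
      calc _ = ∫ ω, ∑ t ∈ Finset.range n,
              {ω : ℕ → S | ω t = s}.indicator (fun _ => Real.log ρ) ω ∂π.pathMeasure := by
            rw [integral_finsetSum _ fun t _ => (integrable_const _).indicator (hmeas t),
              Finset.sum_mul]
            exact Finset.sum_congr rfl fun t _ => by
              rw [integral_indicator_const _ (hmeas t), smul_eq_mul]
        _ ≤ _ := by
            refine integral_mono (integrable_finsetSum _ fun t _ =>
              (integrable_const _).indicator (hmeas t)) hfπ fun ω => ?_
            refine Finset.sum_le_sum fun t _ => ?_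
            by_cases ht : ω t = s
            · simp [ht, hs]
            · simp only [Set.indicator, Set.mem_ofPred_eq, ht, if_false]
              split_ifs
              exacts [le_rfl, hlog.le]
    have hreal' := le_of_mul_le_mul_right (hreal.trans hle) hlog
    calc _ = ∑ t ∈ Finset.range n, ENNReal.ofReal (π.pathMeasure.real {ω | ω t = s}) :=
          Finset.sum_congr rfl fun t _ => (ofReal_measureReal (measure_ne_top _ _)).symm
      _ = ENNReal.ofReal (∑ t ∈ Finset.range n, π.pathMeasure.real {ω | ω t = s}) :=
          (ENNReal.ofReal_sum_of_nonneg fun t _ => measureReal_nonneg).symm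
      _ ≤ _ := ENNReal.ofReal_le_ofReal hreal'
  refine lt_of_le_of_lt ?_ (ENNReal.ofReal_lt_top (r := B))
  refine le_trans (ENNReal.tsum_le_tsum fun t => ?_) (ENNReal.tsum_le_of_sum_range_le hsum)
  exact mul_le_of_le_one_right' (by exact_mod_cast π.prob_le_one t s a)

theorem measurable_liftPath {Q : Type*} [Finite Q] [MeasurableSpace Q]
    [MeasurableSingletonClass Q] (𝒜 : DFA (Set AP) Q) : Measurable (M.liftPath 𝒜) := by
  refine measurable_pi_iff.2 fun n => ?_
  induction n with
  | zero =>
    exact (measurable_of_countable fun s => (s, 𝒜.step 𝒜.start (M.label s))).comp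
      (measurable_pi_apply 0)
  | succ n ih =>
    exact (measurable_of_countable fun p : (S × Q) × S => (p.2, 𝒜.step p.1.2 (M.label p.2))).comp
      (ih.prodMk (measurable_pi_apply (n + 1)))

/-- The automaton component is a deterministic function of the state history, so the lifted paths
have the initial state and Markov property that characterize the path measure on the product. -/
theorem Policy.pathMeasure_induced {Q : Type*} [Fintype Q] [MeasurableSpace Q]
    [MeasurableSingletonClass Q] (π : M.Policy) (𝒜 : DFA (Set AP) Q) :
    (π.induced 𝒜).pathMeasure = π.pathMeasure.map (M.liftPath 𝒜) := by
  have hm : Measurable (M.liftPath 𝒜) := measurable_liftPath 𝒜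
  have := Measure.isProbabilityMeasure_map (μ := π.pathMeasure) hm.aemeasurable
  symm
  refine Policy.eq_pathMeasure _ _ ?_ fun n G => ?_
  · refine (ae_map_iff hm.aemeasurable
      (measurable_pi_apply 0 (measurableSet_singleton (M.prod 𝒜).init))).2 ?_
    filter_upwards [π.ae_pathMeasure_zero] with ω hω
    simp [liftPath, hω, prod]
  -- Padding a finite history with `M.init` is harmless, since `liftPath` up to time `n` reads only
  -- the first `n + 1` states. It makes the lifted history a function of the history in `M`.
  · let e : ((_ : Finset.Iic n) → S) → ℕ → S := fun x i =>
      if hi : i ≤ n then x ⟨i, Finset.mem_Iic.2 hi⟩ else M.init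
    have he : ∀ (ω : ℕ → S), ∀ i ≤ n,
        M.liftPath 𝒜 (e (frestrictLe n ω)) i = M.liftPath 𝒜 ω i := by
      intro ω i hi
      refine liftPath_congr 𝒜 fun j hj => ?_
      simp [e, hj.trans hi]
    have her : ∀ ω : ℕ → S, frestrictLe (π := fun _ => S × Q) n
        (M.liftPath 𝒜 (e (frestrictLe n ω))) = frestrictLe n (M.liftPath 𝒜 ω) := by
      intro ω
      ext1 ⟨i, hi⟩
      exact he ω i (Finset.mem_Iic.1 hi)
    have h := π.lintegral_pathMeasure_succ n fun x s =>
      G (frestrictLe n (M.liftPath 𝒜 (e x))) (s, 𝒜.step (M.liftPath 𝒜 (e x) n).2 (M.label s))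
    simp only [her, he _ n le_rfl] at h
    have hG : Measurable fun p : ((_ : Finset.Iic n) → S × Q) × (S × Q) => G p.1 p.2 :=
      measurable_of_countable _
    have hG1 : Measurable fun ω : ℕ → S × Q => G (frestrictLe n ω) (ω (n + 1)) :=
      hG.comp ((Preorder.measurable_frestrictLe (X := fun _ => S × Q) n).prodMk
        (measurable_pi_apply (X := fun _ => S × Q) (n + 1)))
    have hG2 : Measurable fun ω : ℕ → S × Q =>
        ∑ y, ((M.prod 𝒜).transProb ((π.induced 𝒜).prob n (ω n)) (ω n) y : ℝ≥0∞) *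
          G (frestrictLe n ω) y :=
      Finset.measurable_sum _ fun y _ => Measurable.mul
        ((measurable_of_countable fun x : S × Q =>
          ((M.prod 𝒜).transProb ((π.induced 𝒜).prob n x) x y : ℝ≥0∞)).comp
            (measurable_pi_apply (X := fun _ => S × Q) n))
        ((measurable_of_countable fun p => G p y).comp
          (Preorder.measurable_frestrictLe (X := fun _ => S × Q) n))
    rw [lintegral_map hG1 hm, lintegral_map hG2 hm]
    refine h.trans (lintegral_congr fun ω => ?_)
    rw [Policy.sum_transProb_induced]
    simp only [liftPath_fst]

end MDP
end Deceptive

theorem mainTheorem3 {S A AP QS QA : Type*} [Fintype S] [Finite A] [Finite AP]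
    [Fintype QS] [Fintype QA]
    [MeasurableSpace S] [MeasurableSingletonClass S]
    [MeasurableSpace QS] [MeasurableSingletonClass QS]
    [MeasurableSpace QA] [MeasurableSingletonClass QA]
    (M : Deceptive.MDP S A AP)
    (φS φA : Deceptive.LTL AP) (hφS : φS.IsCoSafe) (hφA : φA.IsCoSafe)
    (𝒜S : DFA (Set AP) QS) (h𝒜S : Deceptive.Represents 𝒜S φS)
    (𝒜A : DFA (Set AP) QA) (h𝒜A : Deceptive.Represents 𝒜A φA)
    (ν : ℝ) (hν : ν ∈ Set.Icc (0 : ℝ) 1)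
    (σ : (M.prod (Deceptive.prodDFA 𝒜S 𝒜A)).StationaryPolicy) :
    -- the deceptive problem on the product MDP
    (∀ πA : (M.prod (Deceptive.prodDFA 𝒜S 𝒜A)).Policy,
      Deceptive.MDP.deceptiveValue σ.toPolicy
        (Deceptive.reachPaths (Deceptive.agentAccepting S 𝒜A)) ν ≠ ∞ →
      Deceptive.MDP.IsOptimalDeceptive σ.toPolicy
        (Deceptive.reachPaths (Deceptive.agentAccepting S 𝒜A)) ν πA →
      ∀ s ∉ σ.closedStates, ∀ a ∈ (M.prod (Deceptive.prodDFA 𝒜S 𝒜A)).avail s,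
        πA.residenceTime s a < ∞) ∧
    -- the deceptive problem on the MDP itself, with a reference policy that induces `σ`
    (∀ πS πA : M.Policy,
      πS.induced (Deceptive.prodDFA 𝒜S 𝒜A) = σ.toPolicy →
      Deceptive.MDP.deceptiveValue πS (M.satPaths φA) ν ≠ ∞ →
      Deceptive.MDP.IsOptimalDeceptive πS (M.satPaths φA) ν πA →
      ∀ s ∉ σ.closedStates, ∀ a ∈ (M.prod (Deceptive.prodDFA 𝒜S 𝒜A)).avail s,
        (πA.induced (Deceptive.prodDFA 𝒜S 𝒜A)).residenceTime s a < ∞) := by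
  refine ⟨fun πA hfin hopt s hs a _ => ?_, fun πS πA hσ hfin hopt s hs a _ => ?_⟩
  · exact πA.residenceTime_lt_top σ (hopt.2 ▸ hfin) hs
  · refine (πA.induced _).residenceTime_lt_top σ ?_ hs
    rw [← hσ, Deceptive.MDP.Policy.pathMeasure_induced, Deceptive.MDP.Policy.pathMeasure_induced]
    -- Data processing: both measures are images under the same `liftPath`.
    exact ne_top_of_le_ne_top (hopt.2 ▸ hfin)
      (klDiv_map_le _ _ (Deceptive.MDP.measurable_liftPath _))
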